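/- A partition is a nonempty finite nonincreasing sequence $\lambda=[\lambda_1,\dots,\lambda_m]$ of positive integers. For partitions $\lambda=[\lambda_1,\dots,\lambda_m]$ and $\mu=[\mu_1,\dots,\mu_n]$, the product $\lambda\times\mu$ is the partition whose entries are all the products $\lambda_i\mu_j$, counted with multiplicity and put in nonincreasing order, and $\lambda^{\times N}$ is the $N$-fold product of $\lambda$ with itself. We say that - $\lambda$ embeds into $\mu$, $\lambda\hookrightarrow\mu$, if there is a map $\varphi:\{1,\dots,m\}\to\{1,\dots,n\}$ with $\sum_{i\in\varphi^{-1}(j)}\lambda_i\le\mu_j$ for all $j$; - $\lambda$ is supermajorized by $\mu$, $\lambda\preccurlyeq_S\mu$, if $\sum_{\lambda_i\ge x}\lambda_i\le\sum_{\mu_j\ge x}\mu_j$ for every $x\in\mathbb N$; - $\lambda$ stably embeds into $\mu$, $\lambda\overset{s}{\hookrightarrow}\mu$, if $\lambda\times\nu\hookrightarrow\mu\times\nu$ for some partition $\nu$; - $\lambda$ bulk-embeds into $\mu$, $\lambda\overset{b}{\hookrightarrow}\mu$, if for every rational $\epsilon>0$ there is an integer $N\ge1$ such that $N(1+\epsilon)$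 is an integer and $\lambda^{\times N}\hookrightarrow\mu^{\times N(1+\epsilon)}$. Writing $a^k$ for $k$ entries equal to $a$, let $\lambda_1=[2,2,2,2]$, $\lambda_2=[8^4,4^4]$, $\lambda_3=[4,2,2]$, $\mu_1=[4,1^8]$, $\mu_2=[3,3,3]$, $\mu_3=[16,2^{16},1^{16}]$ and $\mu_4=[5,3]$. Then: 1. $\lambda_1\overset{s}{\hookrightarrow}\mu_1$, and in fact $\lambda_1\times\nu\hookrightarrow\mu_1\times\nu$ for $\nu=[2,1,1]$; but $\lambda_1\not\preccurlyeq_S\mu_1$ and $\lambda_1\not\hookrightarrow\mu_1$. 2. $\lambda_1\preccurlyeq_S\mu_2$, but $\lambda_1\not\hookrightarrow\mu_2$. 3. $\lambda_2\overset{b}{\hookrightarrow}\mu_3$, but $\lambda_2$ does not stably embed into $\mu_3$ and $\lambda_2\not\preccurlyeq_S\mu_3$. 4. $\lambda_3\preccurlyeq_S\mu_4$, but $\lambda_3$ does not stably embed into $\mu_4$. Consequently none of the following implications holds for all partitions $\lambda,\mu$: $$\lambda\preccurlyeq_S\mu\Rightarrow\lambda\hookrightarrow\mu,\qquad \lambda\overset{s}{\hookrightarrow}\mu\Rightarrow\lambda\hookrightarrow\mu,\qquad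 \lambda\overset{b}{\hookrightarrow}\mu\Rightarrow\lambda\preccurlyeq_S\mu,\qquad \lambda\overset{b}{\hookrightarrow}\mu\Rightarrow\lambda\overset{s}{\hookrightarrow}\mu,$$ and stable embeddability and supermajorization are incomparable: neither $\lambda\overset{s}{\hookrightarrow}\mu\Rightarrow\lambda\preccurlyeq_S\mu$ nor $\lambda\preccurlyeq_S\mu\Rightarrow\lambda\overset{s}{\hookrightarrow}\mu$ holds for all partitions $\lambda,\mu$. -/

import Mathlib

/-- An integral partition: a nonempty finite nonincreasing sequence of positive integers. -/
@[ext]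
structure IntPartition where
  entries : List ℕ
  nonincreasing : entries.Pairwise (fun a b => a ≥ b)
  pos : ∀ a ∈ entries, 0 < a
  nonempty : entries ≠ []

namespace IntPartition

/-- The product `a × b`: all the products of an entry of `a` with an entry of `b`, with
multiplicity, arranged in nonincreasing order. -/
def prod (a b : IntPartition) : IntPartition where
  entries := (a.entries.flatMap fun x => b.entries.map fun y => x * y).insertionSort
    (fun x y => x ≥ y)
  nonincreasing := List.pairwise_insertionSort _ _
  pos := by
    intro z hz
    rw [List.mem_insertionSort] at hz
    simp only [List.mem_flatMap, List.mem_map] at hz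
    obtain ⟨x, hx, y, hy, rfl⟩ := hz
    exact Nat.mul_pos (a.pos x hx) (b.pos y hy)
  nonempty := by
    obtain ⟨x, hx⟩ := List.exists_mem_of_ne_nil _ a.nonempty
    obtain ⟨y, hy⟩ := List.exists_mem_of_ne_nil _ b.nonempty
    refine List.ne_nil_of_mem (a := x * y) ?_
    rw [List.mem_insertionSort]
    exact List.mem_flatMap.2 ⟨x, hx, List.mem_map.2 ⟨y, hy, rfl⟩⟩

/-- The partition `[1]`, the unit for the product. -/
def one : IntPartition := ⟨[1], by decide, by decide, by decide⟩

/-- The `n`-fold product `a × a × ⋯ × a`. -/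
def pow (a : IntPartition) : ℕ → IntPartition
  | 0 => one
  | n + 1 => (pow a n).prod a

/-- `a` embeds into `b`: the entries of `a` (blocks) can be distributed over the entries of `b`
(bins) so that the blocks in each bin have total size at most the size of that bin. -/
def Embeds (a b : IntPartition) : Prop :=
  ∃ φ : Fin a.entries.length → Fin b.entries.length,
    ∀ j, ∑ i with φ i = j, a.entries.get i ≤ b.entries.get j

/-- `a` is supermajorized by `b` : for every `x`, the sum of the entries of `a` that are at least
`x` is at most the corresponding sum for `b`. -/
def SupermajorizedBy (a b : IntPartition) : Prop :=
  ∀ x : ℕ, (a.entries.filter fun y => x ≤ y).sum ≤ (b.entries.filter fun y => x ≤ y).sum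

/-- `a` stably embeds into `b` : `a × ν` embeds into `b × ν` for some partition `ν`. -/
def StablyEmbeds (a b : IntPartition) : Prop :=
  ∃ ν : IntPartition, (a.prod ν).Embeds (b.prod ν)

/-- `a` bulk-embeds into `b` : for every rational `ε > 0` there is a positive integer `N` for which
`N (1 + ε)` is an integer `M` and the `N`-th power of `a` embeds into the `M`-th power of `b`. -/
def BulkEmbeds (a b : IntPartition) : Prop :=
  ∀ ε : ℚ, 0 < ε → ∃ N M : ℕ, 0 < N ∧ (M : ℚ) = N * (1 + ε) ∧ (a.pow N).Embeds (b.pow M)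

/-- `[2, 2, 2, 2]` -/
def lam1 : IntPartition := ⟨[2, 2, 2, 2], by decide, by decide, by decide⟩

/-- `[8, 8, 8, 8, 4, 4, 4, 4]` -/
def lam2 : IntPartition := ⟨[8, 8, 8, 8, 4, 4, 4, 4], by decide, by decide, by decide⟩

/-- `[4, 2, 2]` -/
def lam3 : IntPartition := ⟨[4, 2, 2], by decide, by decide, by decide⟩

/-- `[4, 1, …, 1]` with eight entries `1` -/
def mu1 : IntPartition := ⟨4 :: List.replicate 8 1, by decide, by decide, by decide⟩

/-- `[3, 3, 3]` -/
def mu2 : IntPartition := ⟨[3, 3, 3], by decide, by decide, by decide⟩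

/-- `[16, 2, …, 2, 1, …, 1]` with sixteen entries `2` and sixteen entries `1` -/
def mu3 : IntPartition :=
  ⟨16 :: (List.replicate 16 2 ++ List.replicate 16 1), by decide, by decide, by decide⟩

/-- `[5, 3]` -/
def mu4 : IntPartition := ⟨[5, 3], by decide, by decide, by decide⟩

/-- `[2, 1, 1]` -/
def nu1 : IntPartition := ⟨[2, 1, 1], by decide, by decide, by decide⟩

end IntPartition

/-!
The only substantial claims are the two failures of stable embedding and the bulk embedding.

*Failure of stable embedding.* If a strictly increasing superadditive function `f` has the same sum
over the blocks and over the bins, an embedding must fill every bin exactly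
(`bins_filled_of_sum_map_eq`). When `f` is multiplicative, this equality of sums survives the
product with any partition `ν` (`sum_map_prod`), so it also constrains stable embeddings. For
`[4,2,2]` and `[5,3]` take `f x = x`: exact filling makes every entry of `ν` divisible by all powers
of two. For the pair with the blocks `8` and `4` take `f x = x ^ p` with `2 ^ p = 1 + √5`: exact
filling contradicts the different total sizes.

*Bulk embedding.* All entries are powers of two, so the two partitions are encoded by the
polynomials `P = 4 X³ + 4 X²` and `Q = X⁴ + 16 X + 16`, and products of partitions by products of
polynomials (`genPoly_prod`). If `P ^ N ≤ Q ^ M` coefficientwise, the entries of the `N`-th power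
even form a sublist of those of the `M`-th power (`embeds_of_coeffLE_genPoly`). Now
`Q - P = (X² - 2 X - 4)²` is nonnegative on the reals, with a positive double root at `1 + √5`. The
square `W` of a long geometric series in `X / (1 + √5)` satisfies `W P ≤ (1 + η) W Q`
coefficientwise (`exists_catalyst`), hence `W P ^ n ≤ (1 + η) ^ n W Q ^ n` for all `n`
(`CoeffLE.catalytic_pow`). Since `1 ≤ W ≤ K Q ^ k` for some `K` and `k`, the catalyst can be removed
at a cost that does not depend on `n`, and the factor `Q ^ (ε n)` pays for that and for
`(1 + η) ^ n`.
-/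

/-! ### Products and additive functionals -/

namespace IntPartition

open Polynomial

/-- Sums over a product factor for any function that is multiplicative on the entries involved.
It is used for total sizes, for power sums, and for generating polynomials. -/
theorem sum_map_prod {R : Type*} [CommSemiring R] (f : ℕ → R) (a b : IntPartition)
    (h : ∀ x ∈ a.entries, ∀ y ∈ b.entries, f (x * y) = f x * f y) :
    ((a.prod b).entries.map f).sum = (a.entries.map f).sum * (b.entries.map f).sum := by
  have h1 : ((a.prod b).entries.map f).sum =
      ((a.entries.flatMap fun x => b.entries.map fun y => x * y).map f).sum :=
    ((List.perm_insertionSort _ _).map f).sum_eq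
  rw [h1]
  generalize a.entries = l at h
  induction l with
  | nil => simp
  | cons x l ih =>
    have h2 : ((b.entries.map fun y => x * y).map f).sum = f x * (b.entries.map f).sum := by
      rw [List.map_map, ← List.sum_map_mul_left]
      congr 1
      exact List.map_congr_left fun y hy => h x (by simp) y hy
    rw [List.flatMap_cons, List.map_append, List.sum_append, h2,
      ih fun x hx => h x (List.mem_cons_of_mem _ hx), List.map_cons, List.sum_cons, add_mul]

theorem mem_prod {a b : IntPartition} {z : ℕ} :
    z ∈ (a.prod b).entries ↔ ∃ x ∈ a.entries, ∃ y ∈ b.entries, x * y = z := by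
  simp [prod, List.mem_insertionSort, List.mem_flatMap, List.mem_map]

theorem sum_prod (a b : IntPartition) :
    (a.prod b).entries.sum = a.entries.sum * b.entries.sum := by
  simpa using sum_map_prod (fun x : ℕ => x) a b (fun _ _ _ _ => rfl)

theorem sum_entries_pos (a : IntPartition) : 0 < a.entries.sum := by
  obtain ⟨x, hx⟩ := List.exists_mem_of_ne_nil _ a.nonempty
  exact (a.pos x hx).trans_le (List.single_le_sum (fun _ _ => Nat.zero_le _) x hx)

theorem sum_map_eq_sum_fin {R : Type*} [AddCommMonoid R] (f : ℕ → R) (l : List ℕ) :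
    (l.map f).sum = ∑ i : Fin l.length, f (l.get i) := by
  rw [← List.sum_ofFn]
  congr 1
  apply List.ext_getElem <;> simp

/-! ### Obstructions to embedding -/

/-- A strictly increasing superadditive functional detects unused space: if it takes the same total
on blocks and bins, then every bin is filled exactly. -/
theorem bins_filled_of_sum_map_eq {a b : IntPartition} (f : ℕ → ℝ) (hf : StrictMono f)
    (h0 : f 0 = 0) (hadd : ∀ x y, f x + f y ≤ f (x + y))
    {φ : Fin a.entries.length → Fin b.entries.length}
    (hφ : ∀ j, ∑ i with φ i = j, a.entries.get i ≤ b.entries.get j)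
    (h : (a.entries.map f).sum = (b.entries.map f).sum) (j : Fin b.entries.length) :
    ∑ i with φ i = j, a.entries.get i = b.entries.get j := by
  have hsum : ∀ s : Finset (Fin a.entries.length),
      ∑ i ∈ s, f (a.entries.get i) ≤ f (∑ i ∈ s, a.entries.get i) := by
    intro s
    induction s using Finset.cons_induction with
    | empty => simp [h0]
    | cons i s hi ih =>
      rw [Finset.sum_cons, Finset.sum_cons]
      exact (add_le_add le_rfl ih).trans (hadd _ _)
  have hle : ∀ j ∈ (Finset.univ : Finset (Fin b.entries.length)),
      ∑ i with φ i = j, f (a.entries.get i) ≤ f (b.entries.get j) :=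
    fun j _ => (hsum _).trans (hf.monotone (hφ j))
  rw [sum_map_eq_sum_fin, sum_map_eq_sum_fin, ← Finset.sum_fiberwise Finset.univ φ] at h
  have hj := (Finset.sum_eq_sum_iff_of_le hle).1 h j (Finset.mem_univ j)
  exact (hφ j).antisymm (hf.le_iff_le.1 (hj.symm.le.trans (hsum _)))

theorem sum_eq_of_bins_filled {a b : IntPartition}
    {φ : Fin a.entries.length → Fin b.entries.length}
    (hφ : ∀ j, ∑ i with φ i = j, a.entries.get i = b.entries.get j) :
    a.entries.sum = b.entries.sum := by
  have h := fun l : List ℕ => sum_map_eq_sum_fin (fun x : ℕ => x) l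
  simp only [List.map_id'] at h
  rw [h, h, ← Finset.sum_fiberwise Finset.univ φ]
  exact Finset.sum_congr rfl fun j _ => hφ j

/-- The total sizes agree, so for a catalyst `ν` every bin would be filled exactly. All blocks
are even multiples of entries of `ν`. So if `2 ^ n` divides all entries of `ν`, then `2 ^ (n + 1)`
divides all bins `5 * y`, hence all entries `y` of `ν`; thus the entries of `ν` would be divisible
by every power of two. -/
theorem not_stablyEmbeds_lam3_mu4 : ¬ lam3.StablyEmbeds mu4 := by
  rintro ⟨ν, φ, hφ⟩
  have hfill := bins_filled_of_sum_map_eq (fun x : ℕ => (x : ℝ)) Nat.strictMono_cast (by simp)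
    (by intro x y; simp) hφ (by
      rw [sum_map_prod _ _ _ (by intros; push_cast; rfl),
        sum_map_prod _ _ _ (by intros; push_cast; rfl)]
      norm_num [lam3, mu4])
  have hdvd : ∀ n : ℕ, ∀ y ∈ ν.entries, 2 ^ n ∣ y := by
    intro n
    induction n with
    | zero => simp
    | succ n ih =>
      have hblock : ∀ z ∈ (lam3.prod ν).entries, 2 ^ (n + 1) ∣ z := by
        intro z hz
        obtain ⟨x, hx, y, hy, rfl⟩ := mem_prod.1 hz
        have hx2 : 2 ∣ x := by
          simp only [lam3, List.mem_cons, List.not_mem_nil, or_false] at hx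
          omega
        rw [pow_succ']
        exact mul_dvd_mul hx2 (ih y hy)
      have hbin : ∀ z ∈ (mu4.prod ν).entries, 2 ^ (n + 1) ∣ z := by
        intro z hz
        obtain ⟨j, rfl⟩ := List.mem_iff_get.1 hz
        rw [← hfill j]
        exact Finset.dvd_sum fun i _ => hblock _ (List.get_mem _ _)
      intro y hy
      have h5 := hbin (5 * y) (mem_prod.2 ⟨5, by simp [mu4], y, hy, rfl⟩)
      have hcop : Nat.Coprime (2 ^ (n + 1)) 5 := Nat.Coprime.pow_left _ (by norm_num)
      exact hcop.dvd_of_dvd_mul_left h5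
  obtain ⟨y, hy⟩ := List.exists_mem_of_ne_nil _ ν.nonempty
  exact absurd (Nat.le_of_dvd (ν.pos y hy) (hdvd y y hy)) (not_le.2 Nat.lt_two_pow_self)

/-- At the exponent `p` with `2 ^ p = 1 + √5` the `p`-th power sums of both partitions agree,
because `x ^ 4 + 16 * x + 16 - (4 * x ^ 3 + 4 * x ^ 2) = (x ^ 2 - 2 * x - 4) ^ 2`. Since `p > 1`,
an embedding would fill all bins exactly, against the total sizes `48` and `64`. -/
theorem not_stablyEmbeds_lam2_mu3 : ¬ lam2.StablyEmbeds mu3 := by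
  rintro ⟨ν, φ, hφ⟩
  have h5 : (√5 : ℝ) ^ 2 = 5 := Real.sq_sqrt (by norm_num)
  have h5p : (0 : ℝ) ≤ √5 := Real.sqrt_nonneg 5
  have h51 : (1 : ℝ) ≤ √5 := by nlinarith
  obtain ⟨p, hp⟩ : ∃ p : ℝ, p = Real.logb 2 (1 + √5) := ⟨_, rfl⟩
  have h2p : (2 : ℝ) ^ p = 1 + √5 := by
    rw [hp]; exact Real.rpow_logb (by norm_num) (by norm_num) (by linarith)
  have hp1 : 1 ≤ p := by
    rw [hp, Real.le_logb_iff_rpow_le (by norm_num) (by linarith), Real.rpow_one]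
    linarith
  have hp0 : 0 < p := by linarith
  have hmul : ∀ x y : ℕ, ((x * y : ℕ) : ℝ) ^ p = (x : ℝ) ^ p * (y : ℝ) ^ p := by
    intro x y
    rw [Nat.cast_mul, Real.mul_rpow (Nat.cast_nonneg _) (Nat.cast_nonneg _)]
  have h4p : (4 : ℝ) ^ p = (1 + √5) ^ 2 := by
    have h := hmul 2 2
    norm_num [h2p] at h
    rw [h]; ring
  have h8p : (8 : ℝ) ^ p = (1 + √5) ^ 3 := by
    have h := hmul 2 4
    norm_num [h2p, h4p] at h
    rw [h]; ring
  have h16p : (16 : ℝ) ^ p = (1 + √5) ^ 4 := by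
    have h := hmul 4 4
    norm_num [h4p] at h
    rw [h]; ring
  have hfill := bins_filled_of_sum_map_eq (fun x : ℕ => (x : ℝ) ^ p)
    (fun x y hxy => Real.rpow_lt_rpow (Nat.cast_nonneg _) (Nat.cast_lt.2 hxy) hp0)
    (by simp [hp0.ne'])
    (by
      intro x y
      push_cast
      exact Real.add_rpow_le_rpow_add (Nat.cast_nonneg _) (Nat.cast_nonneg _) hp1)
    hφ (by
      rw [sum_map_prod _ _ _ (fun x _ y _ => hmul x y),
        sum_map_prod _ _ _ (fun x _ y _ => hmul x y)]
      congr 1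
      simp only [lam2, mu3, List.map_cons, List.map_nil, List.sum_cons, List.sum_nil,
        List.map_append, List.map_replicate, List.sum_append, List.sum_replicate, Nat.cast_ofNat,
        Nat.cast_one, Real.one_rpow, h2p, h4p, h8p, h16p, nsmul_eq_mul]
      linear_combination (-(√5 ^ 2 - 5)) * h5)
  have h := sum_eq_of_bins_filled hfill
  rw [sum_prod, sum_prod] at h
  have hν := ν.sum_entries_pos
  have hl : lam2.entries.sum = 48 := by decide
  have hm : mu3.entries.sum = 64 := by decide
  rw [hl, hm] at h
  omega

theorem not_embeds_lam1_mu1 : ¬ lam1.Embeds mu1 := by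
  rintro ⟨φ, hφ⟩
  have hsmall : ∀ j : Fin mu1.entries.length, j ≠ ⟨0, by decide⟩ → mu1.entries.get j < 2 := by
    decide
  have hblock : ∀ i : Fin lam1.entries.length, lam1.entries.get i = 2 := by decide
  -- A block of size `2` fits only into the bin of size `4`, which cannot hold all four.
  have hzero : ∀ i, φ i = ⟨0, by decide⟩ := by
    intro i
    by_contra hi
    have h1 := hφ (φ i)
    have h2 : lam1.entries.get i ≤ ∑ i' with φ i' = φ i, lam1.entries.get i' :=
      Finset.single_le_sum (f := fun i' => lam1.entries.get i') (fun _ _ => Nat.zero_le _)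
        (Finset.mem_filter.2 ⟨Finset.mem_univ i, rfl⟩)
    have h3 := hsmall _ hi
    have h4 := hblock i
    omega
  obtain rfl : φ = fun _ => ⟨0, by decide⟩ := funext hzero
  exact absurd (hφ ⟨0, by decide⟩) (by decide)

theorem not_embeds_lam1_mu2 : ¬ lam1.Embeds mu2 := by
  rintro ⟨φ, hφ⟩
  obtain ⟨i, i', hne, heq⟩ := Fintype.exists_ne_map_eq_of_card_lt φ (by
    rw [Fintype.card_fin, Fintype.card_fin]; decide)
  have h1 := hφ (φ i)
  have h2 : ∑ k ∈ {i, i'}, lam1.entries.get k ≤ ∑ k with φ k = φ i, lam1.entries.get k :=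
    Finset.sum_le_sum_of_subset (by
      intro k hk
      rcases Finset.mem_insert.1 hk with rfl | hk
      · simp
      · rw [Finset.mem_singleton.1 hk]; simp [heq])
  have hblock : ∀ i : Fin lam1.entries.length, lam1.entries.get i = 2 := by decide
  have hbin : ∀ j : Fin mu2.entries.length, mu2.entries.get j = 3 := by decide
  rw [Finset.sum_pair hne] at h2
  have h3 := hblock i
  have h4 := hblock i'
  have h5 := hbin (φ i)
  omega

/-! ### Explicit embeddings and supermajorizations -/

theorem prod_embeds_lam1_mu1 : (lam1.prod nu1).Embeds (mu1.prod nu1) := by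
  -- The blocks are `[4⁴, 2⁸]` and the bins are `[8, 4², 2⁸, 1¹⁶]`.
  let φ : Fin 12 → Fin 27 := ![0, 0, 1, 2, 3, 4, 5, 6, 7, 8, 9, 10]
  exact ⟨φ, by decide +kernel⟩

theorem supermajorizedBy_lam1_mu2 : lam1.SupermajorizedBy mu2 := by
  intro x
  simp only [lam1, mu2, List.filter_cons, List.filter_nil]
  split_ifs <;> simp_all
  omega

theorem supermajorizedBy_lam3_mu4 : lam3.SupermajorizedBy mu4 := by
  intro x
  simp only [lam3, mu4, List.filter_cons, List.filter_nil]
  split_ifs <;> simp_all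
  all_goals omega

theorem not_supermajorizedBy_lam1_mu1 : ¬ lam1.SupermajorizedBy mu1 :=
  fun h => absurd (h 2) (by decide)

theorem not_supermajorizedBy_lam2_mu3 : ¬ lam2.SupermajorizedBy mu3 :=
  fun h => absurd (h 4) (by decide)

/-! ### Generating polynomials of partitions into powers of two -/

/-- All entries are powers of two. -/
def IsDyadic (a : IntPartition) : Prop := ∀ v ∈ a.entries, ∃ k, v = 2 ^ k

/-- The polynomial whose coefficient at `X ^ k` is the number of entries `v` with
`⌊log₂ v⌋ = k`; for a dyadic partition, the number of entries equal to `2 ^ k`. Real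
coefficients are used because the comparison of such polynomials involves `√5`. -/
noncomputable def genPoly (a : IntPartition) : ℝ[X] :=
  (a.entries.map fun v => (X : ℝ[X]) ^ Nat.log 2 v).sum

theorem IsDyadic.prod {a b : IntPartition} (ha : a.IsDyadic) (hb : b.IsDyadic) :
    (a.prod b).IsDyadic := by
  intro z hz
  obtain ⟨x, hx, y, hy, rfl⟩ := mem_prod.1 hz
  obtain ⟨i, rfl⟩ := ha x hx
  obtain ⟨j, rfl⟩ := hb y hy
  exact ⟨i + j, (pow_add _ _ _).symm⟩

theorem IsDyadic.pow {a : IntPartition} (ha : a.IsDyadic) (n : ℕ) : (a.pow n).IsDyadic := by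
  induction n with
  | zero =>
    intro v hv
    exact ⟨0, by simpa [IntPartition.pow, one] using hv⟩
  | succ n ih => exact ih.prod ha

theorem genPoly_prod {a b : IntPartition} (ha : a.IsDyadic) (hb : b.IsDyadic) :
    (a.prod b).genPoly = a.genPoly * b.genPoly := by
  refine sum_map_prod _ a b fun x hx y hy => ?_
  obtain ⟨i, rfl⟩ := ha x hx
  obtain ⟨j, rfl⟩ := hb y hy
  rw [← pow_add, ← pow_add, Nat.log_pow one_lt_two, Nat.log_pow one_lt_two,
    Nat.log_pow one_lt_two]

theorem genPoly_pow {a : IntPartition} (ha : a.IsDyadic) (n : ℕ) :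
    (a.pow n).genPoly = a.genPoly ^ n := by
  induction n with
  | zero => simp [IntPartition.pow, one, genPoly]
  | succ n ih => rw [pow_succ, ← ih]; exact genPoly_prod (ha.pow n) ha

theorem coeff_genPoly {a : IntPartition} (ha : a.IsDyadic) (k : ℕ) :
    a.genPoly.coeff k = (a.entries.count (2 ^ k) : ℝ) := by
  unfold genPoly
  unfold IsDyadic at ha
  generalize a.entries = l at ha
  induction l with
  | nil => simp
  | cons v l ih =>
    obtain ⟨i, rfl⟩ := ha v (by simp)
    rw [List.map_cons, List.sum_cons, coeff_add, ih fun v hv => ha v (List.mem_cons_of_mem _ hv),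
      Nat.log_pow one_lt_two, coeff_X_pow, List.count_cons, Nat.cast_add, add_comm]
    congr 1
    by_cases h : k = i
    · simp [h]
    · have h' : ¬ i = k := fun e => h e.symm
      simp [h, h']

theorem embeds_of_sublist {a b : IntPartition} (h : a.entries.Sublist b.entries) : a.Embeds b := by
  obtain ⟨f, hf⟩ := List.sublist_iff_exists_fin_orderEmbedding_get_eq.1 h
  refine ⟨f, fun j => ?_⟩
  by_cases hj : ∃ i, f i = j
  · obtain ⟨i, rfl⟩ := hj
    have : (Finset.univ.filter fun i' => f i' = f i) = {i} := by
      ext i'; simp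
    rw [this, Finset.sum_singleton, hf i]
  · push Not at hj
    rw [Finset.filter_false_of_mem fun i _ => hj i]
    simp

/-! ### Coefficientwise comparison of polynomials -/

/-- The coefficientwise order on real polynomials. -/
def CoeffLE (p q : ℝ[X]) : Prop := ∀ k, p.coeff k ≤ q.coeff k

theorem embeds_of_coeffLE_genPoly {a b : IntPartition} (ha : a.IsDyadic) (hb : b.IsDyadic)
    (h : CoeffLE a.genPoly b.genPoly) : a.Embeds b := by
  apply embeds_of_sublist
  have hsub : a.entries.Subperm b.entries := by
    rw [List.subperm_ext_iff]
    intro v hv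
    obtain ⟨k, rfl⟩ := ha v hv
    have hk := h k
    rw [coeff_genPoly ha, coeff_genPoly hb] at hk
    exact_mod_cast hk
  exact List.sublist_of_subperm_of_pairwise hsub a.nonincreasing b.nonincreasing

namespace CoeffLE

variable {p q r s : ℝ[X]}

theorem refl (p : ℝ[X]) : CoeffLE p p := fun _ => le_rfl

theorem trans (h₁ : CoeffLE p q) (h₂ : CoeffLE q r) : CoeffLE p r := fun k => (h₁ k).trans (h₂ k)

theorem add (h₁ : CoeffLE p q) (h₂ : CoeffLE r s) : CoeffLE (p + r) (q + s) := fun k => by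
  rw [coeff_add, coeff_add]; exact add_le_add (h₁ k) (h₂ k)

theorem mul_left (hr : CoeffLE 0 r) (h : CoeffLE p q) : CoeffLE (r * p) (r * q) := fun k => by
  rw [coeff_mul, coeff_mul]
  exact Finset.sum_le_sum fun x _ => mul_le_mul_of_nonneg_left (h _) (by simpa using hr x.1)

theorem mul (hp : CoeffLE 0 p) (hr : CoeffLE 0 r) (h₁ : CoeffLE p q) (h₂ : CoeffLE r s) :
    CoeffLE (p * r) (q * s) := by
  have h := mul_left hr h₁
  rw [mul_comm r, mul_comm r] at h
  exact h.trans (mul_left (hp.trans h₁) h₂)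

theorem zero_mul_zero (hp : CoeffLE 0 p) (hq : CoeffLE 0 q) : CoeffLE 0 (p * q) := by
  simpa using mul_left hp hq

theorem zero_pow (hp : CoeffLE 0 p) (n : ℕ) : CoeffLE 0 (p ^ n) := by
  induction n with
  | zero => intro k; rw [pow_zero, coeff_one, coeff_zero]; split_ifs <;> norm_num
  | succ n ih => rw [pow_succ]; exact zero_mul_zero ih hp

theorem pow (hp : CoeffLE 0 p) (h : CoeffLE p q) (n : ℕ) : CoeffLE (p ^ n) (q ^ n) := by
  induction n with
  | zero => exact refl _
  | succ n ih => rw [pow_succ, pow_succ]; exact mul (zero_pow hp n) hp ih h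

theorem C_le_C {x y : ℝ} (h : x ≤ y) : CoeffLE (C x) (C y) := fun k => by
  rw [coeff_C, coeff_C]; split_ifs <;> simp [h]

theorem zero_C {x : ℝ} (h : 0 ≤ x) : CoeffLE 0 (C x) := by simpa using C_le_C h

theorem zero_X : CoeffLE 0 X := fun k => by
  rw [coeff_X, coeff_zero]; split_ifs <;> norm_num

theorem zero_add_zero (hp : CoeffLE 0 p) (hq : CoeffLE 0 q) : CoeffLE 0 (p + q) := by
  simpa using add hp hq

theorem of_sub (h : CoeffLE 0 (q - p)) : CoeffLE p q := fun k => by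
  have := h k
  rw [coeff_sub, coeff_zero] at this
  linarith

end CoeffLE

/-! ### The catalyst -/

/-- The truncated geometric series `∑_{i < n} (c X) ^ i`. -/
noncomputable def geomPoly (c : ℝ) (n : ℕ) : ℝ[X] := ∑ i ∈ Finset.range n, (C c * X) ^ i

theorem coeff_geomPoly (c : ℝ) (n k : ℕ) :
    (geomPoly c n).coeff k = if k < n then c ^ k else 0 := by
  simp only [geomPoly, mul_pow, ← C_pow, finsetSum_coeff, coeff_C_mul, coeff_X_pow]
  simp

theorem coeff_geomPoly_sq (c : ℝ) {n k : ℕ} (hk : k < n) :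
    (geomPoly c n ^ 2).coeff k = (k + 1) * c ^ k := by
  rw [sq, coeff_mul, Finset.sum_congr rfl (g := fun _ => c ^ k)]
  · simp
  · intro x hx
    have h := Finset.HasAntidiagonal.mem_antidiagonal.1 hx
    rw [coeff_geomPoly, coeff_geomPoly, if_pos (by omega), if_pos (by omega), ← pow_add, h]

theorem zero_geomPoly {c : ℝ} (hc : 0 ≤ c) (n : ℕ) : CoeffLE 0 (geomPoly c n) := fun k => by
  rw [coeff_geomPoly, coeff_zero]; split_ifs <;> positivity

/-- The catalyst `W` is the square of a truncated geometric series with ratio `X / (1 + √5)`.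
The difference of the two polynomials is `(X ^ 2 - 2 * X - 4) ^ 2`, which has the double root
`1 + √5`, so multiplication by `W` telescopes it to a polynomial with only three negative
coefficients. The coefficients of `W` near these places are larger by a factor growing linearly in
the length of the series. -/
theorem exists_catalyst {η : ℝ} (hη : 0 < η) : ∃ W : ℝ[X], CoeffLE 0 W ∧ CoeffLE 1 W ∧
    CoeffLE (W * (4 * X ^ 3 + 4 * X ^ 2)) (C (1 + η) * (W * (X ^ 4 + 16 * X + 16))) := by
  have h5 : (√5 : ℝ) ^ 2 = 5 := Real.sq_sqrt (by norm_num)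
  have h5p : (0 : ℝ) ≤ √5 := Real.sqrt_nonneg 5
  obtain ⟨φ, hφ⟩ : ∃ φ : ℝ, φ = √5 + 1 := ⟨_, rfl⟩
  obtain ⟨ψ, hψ⟩ : ∃ ψ : ℝ, ψ = √5 - 1 := ⟨_, rfl⟩
  obtain ⟨c, hc⟩ : ∃ c : ℝ, c = φ⁻¹ := ⟨_, rfl⟩
  have h51 : (1 : ℝ) ≤ √5 := by nlinarith
  have hψ0 : 0 ≤ ψ := by linarith
  have hφ0 : 0 < φ := by linarith
  have hc0 : 0 < c := by rw [hc]; positivity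
  have hcφ : c * φ = 1 := by rw [hc]; exact inv_mul_cancel₀ hφ0.ne'
  have hc1 : c * ψ ≤ 1 := by
    have : c * ψ ≤ c * φ := mul_le_mul_of_nonneg_left (by linarith) hc0.le
    linarith
  obtain ⟨N, hN⟩ := exists_nat_ge (4 / η)
  have hN' : 4 ≤ η * N := by
    rw [div_le_iff₀ hη] at hN; linarith
  set S := geomPoly c (N + 4) with hS
  have hS0 : CoeffLE 0 S := zero_geomPoly hc0.le _
  have hW0 : CoeffLE 0 (S ^ 2) := hS0.zero_pow 2
  have hX4 : CoeffLE 0 (X ^ 4 : ℝ[X]) := CoeffLE.zero_X.zero_pow 4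
  have hgeom : S * (C c * X - 1) = (C c * X) ^ (N + 4) - 1 := geom_sum_mul _ _
  have hT : CoeffLE 0 ((X + C ψ) ^ 2) :=
    (CoeffLE.zero_X.zero_add_zero (CoeffLE.zero_C hψ0)).zero_pow 2
  refine ⟨S ^ 2, hW0, ?_, CoeffLE.of_sub ?_⟩
  · intro k
    rw [coeff_one]
    split_ifs with h
    · subst h
      rw [coeff_geomPoly_sq _ (by omega)]; simp
    · simpa using hW0 k
  -- The three negative coefficients are absorbed by `η * W * X ^ 4`.
  have hmain : CoeffLE 0 (C η * S ^ 2 - C (2 * φ ^ 2 * c ^ (N + 4)) * (X ^ N * (X + C ψ) ^ 2)) := by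
    have hexp : C (2 * φ ^ 2 * c ^ (N + 4)) * (X ^ N * (X + C ψ) ^ 2) =
        C (2 * c ^ 2 * c ^ N) * X ^ (N + 2) + C (4 * (c * ψ) * c * c ^ N) * X ^ (N + 1) +
          C (2 * (c * ψ) ^ 2 * c ^ N) * X ^ N := by
      have : 2 * φ ^ 2 * c ^ (N + 4) = 2 * c ^ 2 * c ^ N := by
        linear_combination (2 * c ^ 2 * c ^ N * (c * φ + 1)) * hcφ
      rw [this]
      simp only [C_mul, C_pow, C_ofNat]
      ring
    rw [hexp]
    intro k
    have hWk := hW0 k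
    simp only [coeff_zero, coeff_sub, coeff_add, coeff_C_mul, coeff_X_pow] at hWk ⊢
    have hcN : 0 ≤ c ^ N := by positivity
    have hcψ : 0 ≤ c * ψ := by positivity
    by_cases h0 : k = N
    · subst h0
      rw [coeff_geomPoly_sq _ (by omega)]
      simp only [Nat.left_eq_add, OfNat.ofNat_ne_zero, one_ne_zero, if_false, if_true]
      have : 2 * (c * ψ) ^ 2 ≤ η * (k + 1) := by nlinarith
      nlinarith [mul_le_mul_of_nonneg_right this hcN]
    by_cases h1 : k = N + 1
    · subst h1
      rw [coeff_geomPoly_sq _ (by omega)]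
      have e1 : ¬ N + 1 = N + 2 := by omega
      have e2 : ¬ N + 1 = N := by omega
      simp only [e1, e2, if_false, if_true]
      push_cast
      have : 4 * (c * ψ) ≤ η * (N + 1 + 1) := by nlinarith
      have h := mul_le_mul_of_nonneg_right this (mul_nonneg hc0.le hcN)
      rw [pow_succ]
      nlinarith
    by_cases h2 : k = N + 2
    · subst h2
      rw [coeff_geomPoly_sq _ (by omega)]
      have e1 : ¬ N + 2 = N + 1 := by omega
      have e2 : ¬ N + 2 = N := by omega
      simp only [e1, e2, if_false, if_true]
      push_cast
      have : 2 ≤ η * (N + 2 + 1) := by nlinarith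
      have h := mul_le_mul_of_nonneg_right this (mul_nonneg (sq_nonneg c) hcN)
      rw [pow_add c N 2]
      nlinarith
    · simp only [h0, h1, h2, if_false]
      have := mul_nonneg hη.le hWk
      linarith
  have hfactor : (X ^ 2 - 2 * X - 4 : ℝ[X]) = C φ * ((C c * X - 1) * (X + C ψ)) := by
    have e1 : C φ * C c = (1 : ℝ[X]) := by rw [← C_mul, mul_comm, hcφ, C_1]
    have e2 : C φ = C ψ + (2 : ℝ[X]) := by
      rw [← C_ofNat, ← C_add]; congr 1; rw [hφ, hψ]; ring
    have e3 : C φ * C ψ = (4 : ℝ[X]) := by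
      rw [← C_ofNat, ← C_mul]; congr 1; rw [hφ, hψ]; linear_combination h5
    linear_combination (-(X ^ 2 + X * C ψ)) * e1 + e3 + X * e2
  have hdecomp : C (1 + η) * (S ^ 2 * (X ^ 4 + 16 * X + 16)) - S ^ 2 * (4 * X ^ 3 + 4 * X ^ 2) =
      X ^ 4 * (C η * S ^ 2 - C (2 * φ ^ 2 * c ^ (N + 4)) * (X ^ N * (X + C ψ) ^ 2)) +
        (C η * (S ^ 2 * (C 16 * X + C 16)) +
          C φ ^ 2 * (((C c * X) ^ (N + 4)) ^ 2 + C 1) * (X + C ψ) ^ 2) := by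
    have hsq : S ^ 2 * (X ^ 2 - 2 * X - 4) ^ 2 =
        C φ ^ 2 * ((C c * X) ^ (N + 4) - 1) ^ 2 * (X + C ψ) ^ 2 := by
      rw [hfactor, ← hgeom]; ring
    have e : (C (2 * φ ^ 2 * c ^ (N + 4)) * X ^ (N + 4) : ℝ[X]) =
        2 * C φ ^ 2 * (C c * X) ^ (N + 4) := by
      simp only [C_mul, C_pow, C_ofNat]; ring
    rw [C_add, C_1, C_ofNat]
    linear_combination hsq + (X + C ψ) ^ 2 * e
  rw [hdecomp]
  refine (hX4.zero_mul_zero hmain).zero_add_zero (CoeffLE.zero_add_zero ?_ ?_)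
  · refine (CoeffLE.zero_C hη.le).zero_mul_zero (hW0.zero_mul_zero ?_)
    exact ((CoeffLE.zero_C (by norm_num)).zero_mul_zero CoeffLE.zero_X).zero_add_zero
      (CoeffLE.zero_C (by norm_num))
  · refine (((CoeffLE.zero_C hφ0.le).zero_pow 2).zero_mul_zero ?_).zero_mul_zero hT
    exact ((((CoeffLE.zero_C hc0.le).zero_mul_zero CoeffLE.zero_X).zero_pow _).zero_pow
      2).zero_add_zero (CoeffLE.zero_C (by norm_num))

/-! ### Bulk embedding -/

/-- A polynomial is bounded coefficientwise by a multiple of a power of any `q` that dominates `1 + X`,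
since all binomial coefficients `n.choose k` with `k ≤ n` are at least `1`. -/
theorem exists_coeffLE_C_mul_pow (W : ℝ[X]) {q : ℝ[X]} (hq : CoeffLE (1 + X) q) :
    ∃ K : ℝ, 0 ≤ K ∧ CoeffLE W (C K * q ^ W.natDegree) := by
  have h1 : CoeffLE 0 (1 + X : ℝ[X]) := by
    simpa using (CoeffLE.zero_C zero_le_one).zero_add_zero CoeffLE.zero_X
  have hK : 0 ≤ ∑ i ∈ W.support, |W.coeff i| := Finset.sum_nonneg fun _ _ => abs_nonneg _
  refine ⟨∑ i ∈ W.support, |W.coeff i|, hK, ?_⟩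
  refine CoeffLE.trans ?_ ((CoeffLE.zero_C hK).mul_left (h1.pow hq W.natDegree))
  intro k
  rw [coeff_C_mul, coeff_one_add_X_pow]
  by_cases hk : W.coeff k = 0
  · rw [hk]; positivity
  · have h2 : |W.coeff k| ≤ ∑ i ∈ W.support, |W.coeff i| :=
      Finset.single_le_sum (f := fun i => |W.coeff i|) (fun _ _ => abs_nonneg _)
        (mem_support_iff.2 hk)
    have h3 : (1 : ℝ) ≤ (W.natDegree.choose k : ℝ) := by
      exact_mod_cast Nat.choose_pos (le_natDegree_of_ne_zero hk)
    calc W.coeff k ≤ |W.coeff k| := le_abs_self _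
      _ ≤ (∑ i ∈ W.support, |W.coeff i|) * 1 := by rw [mul_one]; exact h2
      _ ≤ _ := mul_le_mul_of_nonneg_left h3 hK

theorem CoeffLE.catalytic_pow {W p q : ℝ[X]} {c : ℝ} (hc : 0 ≤ c) (hp : CoeffLE 0 p)
    (hq : CoeffLE 0 q) (h : CoeffLE (W * p) (C c * (W * q))) (n : ℕ) :
    CoeffLE (W * p ^ n) (C (c ^ n) * (W * q ^ n)) := by
  induction n with
  | zero => simpa using CoeffLE.refl W
  | succ n ih =>
    have h1 := hp.mul_left ih
    have h2 := ((CoeffLE.zero_C (pow_nonneg hc n)).zero_mul_zero (hq.zero_pow n)).mul_left h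
    have e1 : W * p ^ (n + 1) = p * (W * p ^ n) := by ring
    have e2 : p * (C (c ^ n) * (W * q ^ n)) = C (c ^ n) * q ^ n * (W * p) := by ring
    have e3 : C (c ^ (n + 1)) * (W * q ^ (n + 1)) = C (c ^ n) * q ^ n * (C c * (W * q)) := by
      rw [pow_succ c, C_mul]; ring
    rw [e1, e3]
    rw [e2] at h1
    exact h1.trans h2

theorem isDyadic_lam2 : lam2.IsDyadic := by
  intro v hv
  simp only [lam2, List.mem_cons, List.not_mem_nil, or_false] at hv
  have : v = 8 ∨ v = 4 := by tauto
  rcases this with rfl | rfl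
  exacts [⟨3, rfl⟩, ⟨2, rfl⟩]

theorem isDyadic_mu3 : mu3.IsDyadic := by
  intro v hv
  simp only [mu3, List.mem_cons, List.mem_append, List.mem_replicate] at hv
  rcases hv with rfl | ⟨_, rfl⟩ | ⟨_, rfl⟩
  exacts [⟨4, rfl⟩, ⟨1, rfl⟩, ⟨0, rfl⟩]

theorem genPoly_lam2 : lam2.genPoly = 4 * X ^ 3 + 4 * X ^ 2 := by
  have h8 : Nat.log 2 8 = 3 := Nat.log_pow one_lt_two 3
  have h4 : Nat.log 2 4 = 2 := Nat.log_pow one_lt_two 2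
  simp only [genPoly, lam2, List.map_cons, List.map_nil, List.sum_cons, List.sum_nil, h8, h4]
  ring

theorem genPoly_mu3 : mu3.genPoly = X ^ 4 + 16 * X + 16 := by
  have h16 : Nat.log 2 16 = 4 := Nat.log_pow one_lt_two 4
  have h2 : Nat.log 2 2 = 1 := Nat.log_pow one_lt_two 1
  simp only [genPoly, mu3, List.map_cons, List.map_append, List.map_replicate, List.sum_cons,
    List.sum_append, List.sum_replicate, h16, h2, Nat.log_one_right, nsmul_eq_mul]
  push_cast
  ring

/-- Iterating the catalytic comparison costs a fixed power of the larger polynomial and an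
exponential factor of small rate; both are paid for by the factor `16 ^ j` in the constant
coefficient of its `j`-th power. -/
theorem bulkEmbeds_lam2_mu3 : lam2.BulkEmbeds mu3 := by
  intro ε hε
  set p : ℝ[X] := 4 * X ^ 3 + 4 * X ^ 2 with hp
  set q : ℝ[X] := X ^ 4 + 16 * X + 16 with hq
  have hX := CoeffLE.zero_X
  have h4 : CoeffLE 0 (4 : ℝ[X]) := by
    rw [← C_ofNat]; exact CoeffLE.zero_C (by norm_num)
  have hp0 : CoeffLE 0 p :=
    (h4.zero_mul_zero (hX.zero_pow 3)).zero_add_zero (h4.zero_mul_zero (hX.zero_pow 2))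
  have h16q : CoeffLE (C 16) q := by
    apply CoeffLE.of_sub
    have : q - C 16 = X ^ 4 + C 16 * X := by rw [hq, C_ofNat]; ring
    rw [this]
    exact (hX.zero_pow 4).zero_add_zero ((CoeffLE.zero_C (by norm_num)).zero_mul_zero hX)
  have hq1 : CoeffLE (1 + X) q := by
    apply CoeffLE.of_sub
    have : q - (1 + X) = X ^ 4 + (C 15 * X + C 15) := by rw [hq, C_ofNat]; ring
    rw [this]
    have h15 := CoeffLE.zero_C (show (0 : ℝ) ≤ 15 by norm_num)
    exact (hX.zero_pow 4).zero_add_zero ((h15.zero_mul_zero hX).zero_add_zero h15)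
  have h16 := CoeffLE.zero_C (show (0 : ℝ) ≤ 16 by norm_num)
  have hq0 : CoeffLE 0 q := h16.trans h16q
  have hd : 0 < ε.den := ε.den_pos
  have hd' : (0 : ℝ) < ε.den := by exact_mod_cast hd
  obtain ⟨W, hW0, hW1, hW⟩ := exists_catalyst (η := 1 / ε.den) (by positivity)
  obtain ⟨K, hK0, hK⟩ := exists_coeffLE_C_mul_pow W hq1
  set k := W.natDegree
  obtain ⟨m₀, hm₀⟩ := pow_unbounded_of_one_lt (K * 16 ^ k) (show (1 : ℝ) < 5 by norm_num)
  obtain ⟨m, hm⟩ : ∃ m, m = m₀ + k + 1 := ⟨_, rfl⟩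
  obtain ⟨a, ha⟩ := Int.eq_ofNat_of_zero_le (Rat.num_nonneg.2 hε.le)
  have ha1 : 1 ≤ a := by
    have := Rat.num_pos.2 hε
    omega
  have hma : m ≤ m * a := Nat.le_mul_of_pos_right m ha1
  obtain ⟨j, hj⟩ : ∃ j, m * a = k + j := ⟨m * a - k, by omega⟩
  refine ⟨m * ε.den, m * ε.den + m * a, Nat.mul_pos (by omega) hd, ?_, ?_⟩
  · have h1 : ε * ε.den = a := by rw [Rat.mul_den_eq_num, ha]; rfl
    push_cast
    linear_combination (-(m : ℚ)) * h1
  apply embeds_of_coeffLE_genPoly (isDyadic_lam2.pow _) (isDyadic_mu3.pow _)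
  rw [genPoly_pow isDyadic_lam2, genPoly_pow isDyadic_mu3, genPoly_lam2, genPoly_mu3, ← hp, ← hq]
  -- `(1 + 1 / d) ^ d ≤ e < 3`, so over `m * d` steps the loss is at most `3 ^ m`.
  have hloss : (1 + 1 / (ε.den : ℝ)) ^ (m * ε.den) ≤ 3 ^ m := by
    rw [mul_comm, pow_mul]
    refine pow_le_pow_left₀ (by positivity) ?_ m
    have h1 : 1 + 1 / (ε.den : ℝ) ≤ Real.exp (1 / ε.den) := by
      rw [add_comm]; exact Real.add_one_le_exp _
    calc (1 + 1 / (ε.den : ℝ)) ^ ε.den ≤ Real.exp (1 / ε.den) ^ ε.den :=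
          pow_le_pow_left₀ (by positivity) h1 _
      _ = Real.exp 1 := by rw [← Real.exp_nat_mul, mul_one_div_cancel hd'.ne']
      _ ≤ 3 := by linarith [Real.exp_one_lt_d9]
  have hconst : (1 + 1 / (ε.den : ℝ)) ^ (m * ε.den) * K ≤ 16 ^ j := by
    have h1 : K * 16 ^ k ≤ 5 ^ m :=
      hm₀.le.trans (pow_le_pow_right₀ (by norm_num) (by omega))
    have h2 : (3 : ℝ) ^ m * 5 ^ m ≤ 16 ^ m := by
      rw [← mul_pow]; exact pow_le_pow_left₀ (by norm_num) (by norm_num) m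
    have h3 : (16 : ℝ) ^ m ≤ 16 ^ k * 16 ^ j := by
      rw [← pow_add]; exact pow_le_pow_right₀ (by norm_num) (by omega)
    have h4 : (3 : ℝ) ^ m * (K * 16 ^ k) ≤ 3 ^ m * 5 ^ m :=
      mul_le_mul_of_nonneg_left h1 (by positivity)
    have h5 := mul_le_mul_of_nonneg_right hloss hK0
    have h6 : (0 : ℝ) < 16 ^ k := by positivity
    refine le_of_mul_le_mul_right ?_ h6
    nlinarith [mul_le_mul_of_nonneg_right h5 h6.le]
  have hn0 : (0 : ℝ) ≤ 1 + 1 / (ε.den : ℝ) := by positivity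
  set n := m * ε.den
  have hqn := hq0.zero_pow n
  have s1 : CoeffLE (p ^ n) (W * p ^ n) := by
    have := (hp0.zero_pow n).mul_left hW1
    rwa [mul_one, mul_comm] at this
  have s2 := CoeffLE.catalytic_pow hn0 hp0 hq0 hW n
  have s3 := ((CoeffLE.zero_C (pow_nonneg hn0 n)).zero_mul_zero hqn).mul_left hK
  have s4 := (hqn.zero_mul_zero (hq0.zero_pow k)).mul_left
    ((CoeffLE.C_le_C hconst).trans (C_pow (a := (16 : ℝ)) (n := j) ▸ h16.pow h16q j))
  have e1 : C ((1 + 1 / (ε.den : ℝ)) ^ n) * (W * q ^ n) =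
      C ((1 + 1 / (ε.den : ℝ)) ^ n) * q ^ n * W := by ring
  have e2 : C ((1 + 1 / (ε.den : ℝ)) ^ n) * q ^ n * (C K * q ^ k) =
      q ^ n * q ^ k * C ((1 + 1 / (ε.den : ℝ)) ^ n * K) := by rw [C_mul]; ring
  rw [e1] at s2
  rw [e2] at s3
  rw [hj, pow_add, pow_add, ← mul_assoc]
  exact s1.trans (s2.trans (s3.trans s4))

end IntPartition

theorem mainTheorem6 :
    -- the pair `[2,2,2,2]`, `[4,1,1,1,1,1,1,1,1]`, with the witness `[2,1,1]`
    ((IntPartition.lam1.prod IntPartition.nu1).Embeds (IntPartition.mu1.prod IntPartition.nu1) ∧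
      IntPartition.lam1.StablyEmbeds IntPartition.mu1 ∧
      ¬ IntPartition.lam1.SupermajorizedBy IntPartition.mu1 ∧
      ¬ IntPartition.lam1.Embeds IntPartition.mu1) ∧
    -- the pair `[2,2,2,2]`, `[3,3,3]`
    (IntPartition.lam1.SupermajorizedBy IntPartition.mu2 ∧
      ¬ IntPartition.lam1.Embeds IntPartition.mu2) ∧
    -- the pair `[8,8,8,8,4,4,4,4]`, `[16,2,…,2,1,…,1]`
    (IntPartition.lam2.BulkEmbeds IntPartition.mu3 ∧
      ¬ IntPartition.lam2.StablyEmbeds IntPartition.mu3 ∧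
      ¬ IntPartition.lam2.SupermajorizedBy IntPartition.mu3) ∧
    -- the pair `[4,2,2]`, `[5,3]`
    (IntPartition.lam3.SupermajorizedBy IntPartition.mu4 ∧
      ¬ IntPartition.lam3.StablyEmbeds IntPartition.mu4) ∧
    -- the four converses fail
    (¬ (∀ a b : IntPartition, a.SupermajorizedBy b → a.Embeds b) ∧
      ¬ (∀ a b : IntPartition, a.StablyEmbeds b → a.Embeds b) ∧
      ¬ (∀ a b : IntPartition, a.BulkEmbeds b → a.SupermajorizedBy b) ∧
      ¬ (∀ a b : IntPartition, a.BulkEmbeds b → a.StablyEmbeds b)) ∧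
    -- neither of stable embeddability and supermajorization implies the other
    (¬ (∀ a b : IntPartition, a.StablyEmbeds b → a.SupermajorizedBy b) ∧
      ¬ (∀ a b : IntPartition, a.SupermajorizedBy b → a.StablyEmbeds b)) := by
  open IntPartition in
  have hstab : lam1.StablyEmbeds mu1 := ⟨nu1, prod_embeds_lam1_mu1⟩
  open IntPartition in
  exact ⟨⟨prod_embeds_lam1_mu1, hstab, not_supermajorizedBy_lam1_mu1, not_embeds_lam1_mu1⟩,
    ⟨supermajorizedBy_lam1_mu2, not_embeds_lam1_mu2⟩,
    ⟨bulkEmbeds_lam2_mu3, not_stablyEmbeds_lam2_mu3, not_supermajorizedBy_lam2_mu3⟩,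
    ⟨supermajorizedBy_lam3_mu4, not_stablyEmbeds_lam3_mu4⟩,
    ⟨fun h => not_embeds_lam1_mu2 (h _ _ supermajorizedBy_lam1_mu2),
      fun h => not_embeds_lam1_mu1 (h _ _ hstab),
      fun h => not_supermajorizedBy_lam2_mu3 (h _ _ bulkEmbeds_lam2_mu3),
      fun h => not_stablyEmbeds_lam2_mu3 (h _ _ bulkEmbeds_lam2_mu3)⟩,
    ⟨fun h => not_supermajorizedBy_lam1_mu1 (h _ _ hstab),
      fun h => not_stablyEmbeds_lam3_mu4 (h _ _ supermajorizedBy_lam3_mu4)⟩⟩
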